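/- **Jagged overpartitions.** Consider finite (possibly empty) sequences $\lambda=(\lambda_1,\dots,\lambda_s)$ of non-negative integers, each colored $a$, $b$ or $u$, in which only the final occurrence of each positive colored integer may (but need not) be overlined, such that $\lambda_s\notin\{0_a,0_b,\overline{1}_a,\overline{1}_b\}$ and such that $\lambda_i-\lambda_{i+1}$ is, for $1\le i<s$, at least the entry in the row of $\lambda_i$ and the column of $\lambda_{i+1}$ of $$ \begin{array}{c|cccccc} & \overline a & \overline b & \overline u & a & b & u\\ \hline \overline a & 2&0&2&2&0&2\\ \overline b & 2&2&3&2&2&3\\ \overline u & 1&0&1&1&0&1\\ a & 1&-1&1&1&-1&1\\ b & 1&1&2&1&1&2\\ u & 0&-1&0&0&-1&0 \end{array} $$ where a row or column is chosen by the color of the part and by whether the part is overlined. **Theorem.** Let $\overline{C}_2(n;k;i,j)$ be the number of such sequences with sum $n$, with exactly $k$ non-overlined parts, $i$ parts of color $a$ and $j$ parts of color $b$, and in which the final $\ell$ parts are all overlined, where $\ell$ is the number of parts of color $b$ or $u$. This number is finite, and, as an identity of formal power series in $a,b,d,q$, $$ \sum_{n,k,i,j\ge 0}\overline{C}_2(n;k;i,j)\,a^ib^jd^kq^n=(-q;q)_\infty\,(-bq^2;q^2)_\infty\sum_{r\ge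 0}\frac{q^{\binom{r+1}{2}}(ad)^r(-q/d;q)_r}{(q^2;q^2)_r}, $$ where $(x;p)_n=\prod_{k=0}^{n-1}(1-xp^k)$ for $n\in\mathbb{N}\cup\{\infty\}$, and where $d^r(-q/d;q)_r$ stands for the polynomial $\prod_{k=1}^{r}(d+q^k)$. The infinite products and the infinite sum converge coefficientwise. -/

import Mathlib

open scoped MvPowerSeries.WithPiTopology

namespace Jagged

/-- The three colors. -/
inductive Color
  | a
  | b
  | u
  deriving DecidableEq

/-- A colored non-negative integer which may or may not be overlined. -/
structure ColoredPart where
  size : ℕ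
  color : Color
  overlined : Bool
  deriving DecidableEq

/-- The minimal difference `x - y` between successive parts `x`, `y`. It depends on the colors of
both parts and on whether `x` is overlined, but not on whether `y` is overlined. -/
def minDiff (x y : ColoredPart) : ℤ :=
  match x.overlined, x.color, y.color with
  | true, .a, .a => 2
  | true, .a, .b => 0
  | true, .a, .u => 2
  | true, .b, .a => 2
  | true, .b, .b => 2
  | true, .b, .u => 3
  | true, .u, .a => 1
  | true, .u, .b => 0
  | true, .u, .u => 1
  | false, .a, .a => 1
  | false, .a, .b => -1
  | false, .a, .u => 1
  | false, .b, .a => 1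
  | false, .b, .b => 1
  | false, .b, .u => 2
  | false, .u, .a => 0
  | false, .u, .b => -1
  | false, .u, .u => 0

/-- The jagged overpartitions `(λ₁, …, λₛ)`; the empty sequence is one of them. -/
structure IsJaggedOverpartition (l : List ColoredPart) : Prop where
  /-- Only positive parts may be overlined. -/
  pos_of_overlined : ∀ x ∈ l, x.overlined = true → 0 < x.size
  /-- Only the final occurrence of a colored integer may be overlined. -/
  final_occurrence : l.Pairwise fun x y =>
    x.overlined = true → ¬ (y.size = x.size ∧ y.color = x.color)
  /-- The last part is none of `0_a`, `0_b`, overlined `1_a`, overlined `1_b`. -/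
  last_part : ∀ x ∈ l.getLast?, x ∉
    ({⟨0, .a, false⟩, ⟨0, .b, false⟩, ⟨1, .a, true⟩, ⟨1, .b, true⟩} : Set ColoredPart)
  /-- Successive parts satisfy the difference conditions. -/
  difference : l.IsChain fun x y => minDiff x y ≤ (x.size : ℤ) - (y.size : ℤ)

/-- The jagged overpartitions of `n` with `k` non-overlined parts, `i` parts colored `a` and
`j` parts colored `b`. -/
def overpartitions (n k i j : ℕ) : Set (List ColoredPart) :=
  {l | IsJaggedOverpartition l ∧
    (l.map ColoredPart.size).sum = n ∧
    l.countP (fun x => x.overlined = false) = k ∧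
    l.countP (fun x => x.color = .a) = i ∧
    l.countP (fun x => x.color = .b) = j}

/-- The number `ℓ` of parts colored `b` or `u`. -/
def numBU (l : List ColoredPart) : ℕ :=
  l.countP (fun x => x.color = .b ∨ x.color = .u)

/-- The members of `overpartitions n k i j` whose final `ℓ` parts are overlined, where `ℓ` is
the number of parts colored `b` or `u`. -/
def overpartitions₂ (n k i j : ℕ) : Set (List ColoredPart) :=
  {l | l ∈ overpartitions n k i j ∧
    ∀ x ∈ l.drop (l.length - numBU l), x.overlined = true}

/-- The number of elements of `overpartitions₂ n k i j`. -/
noncomputable def C₂ (n k i j : ℕ) : ℕ := (overpartitions₂ n k i j).ncard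

/-- The names of the four formal variables. -/
inductive Var
  | a
  | b
  | d
  | q
  deriving DecidableEq

/-- Formal power series in `a`, `b`, `d`, `q` with rational coefficients, with the topology of
coefficientwise convergence. -/
abbrev Series : Type := MvPowerSeries Var ℚ

/-- The series `∑ C₂(n; k; i, j) a^i b^j d^k q^n`, given by its coefficients. -/
noncomputable def genFun : Series := fun m => (C₂ (m .q) (m .d) (m .a) (m .b) : ℚ)

/-- The variable `a`. -/
noncomputable def a : Series := MvPowerSeries.X .a

/-- The variable `b`. -/
noncomputable def b : Series := MvPowerSeries.X .b

/-- The variable `d`. -/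
noncomputable def d : Series := MvPowerSeries.X .d

/-- The variable `q`. -/
noncomputable def q : Series := MvPowerSeries.X .q

/-- `(x; p)_n = ∏_{k = 0}^{n - 1} (1 - x p^k)`. -/
def qPoch {R : Type*} [CommRing R] (x p : R) (n : ℕ) : R :=
  ∏ k ∈ Finset.range n, (1 - x * p ^ k)

/-- `(x; p)_∞ = ∏_{k ≥ 0} (1 - x p^k)`. -/
noncomputable def qPochInf {R : Type*} [CommRing R] [TopologicalSpace R] (x p : R) : R :=
  ∏' k : ℕ, (1 - x * p ^ k)

/-- `y^n (x / y; p)_n = ∏_{k = 0}^{n - 1} (y - x p^k)`, which is polynomial in `y`. -/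
def qPochScaled {R : Type*} [CommRing R] (y x p : R) (n : ℕ) : R :=
  ∏ k ∈ Finset.range n, (y - x * p ^ k)

theorem qPochScaled_eq {K : Type*} [Field K] {y : K} (hy : y ≠ 0) (x p : K) (n : ℕ) :
    qPochScaled y x p n = y ^ n * qPoch (x / y) p n := by
  unfold qPochScaled qPoch
  rw [← Finset.card_range n, ← Finset.prod_const, Finset.card_range, ← Finset.prod_mul_distrib]
  refine Finset.prod_congr rfl fun k _ => ?_
  field_simp

/-- `q^{r (r + 1) / 2} (a d)^r (-q / d; q)_r / (q²; q²)_r`. The denominator has constant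
coefficient `1`, so the inverse is a genuine one. -/
noncomputable def summand (r : ℕ) : Series :=
  q ^ (r + 1).choose 2 * a ^ r * qPochScaled d (-q) q r * (qPoch (q ^ 2) (q ^ 2) r)⁻¹

end Jagged

namespace Jagged

open MvPowerSeries Filter Topology

/-! ### Convergence of series divisible by high powers of `q` -/

/-! Give a part the level: size, minus one for color `b`. The table of minimal differences then
splits into a term depending on colors alone and an extra 1 when the first part is overlined
(`minDiff_eq`). Subtracting from each level the number of overlines at or after that part leaves a
chain subject only to the color conditions, while the overlines become free flags. Jagged
overpartitions thus correspond to pairs (admissible chain, flags).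

Flags: an overline in position p adds p to the sum. With i parts `a`, the first i positions are free
and give ∏ (d + q^p); the other l positions are forced and give a power of q (`tsum_flags`).

Chains: read from the last part, a chain either starts at level zero, where its head can be removed,
or is a raised chain. The resulting recurrences have a product solution: i, j, k parts of colors
`a`, `b`, `u` give q^(C(i+1,2) + C(j+1,2) - ij) (-q;q)_(i+j) / ((q;q)_k (q²;q²)_i (q²;q²)_j)
(`sizeSeries_chainsAdmissible`).

In the product of both factors the term -ij cancels. Euler's expansion of (x;p)_∞ sums over k, where
(-q;q)_(i+j) is completed to (-q;q)_∞, and then over j, giving (-bq²;q²)_∞. The sum over i remains.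
-/

theorem coeff_eq_zero_of_q_pow_dvd {f : Series} {N : ℕ} (h : q ^ N ∣ f) {m : Var →₀ ℕ}
    (hm : m .q < N) : coeff m f = 0 :=
  X_pow_dvd_iff.1 h m hm

/-- A coefficient at `q`-exponent e only sees the terms not divisible by q^(e+1). -/
theorem summable_of_finite_not_q_pow_dvd {ι : Type*} {f : ι → Series}
    (h : ∀ N, {i | ¬ q ^ N ∣ f i}.Finite) : Summable f := by
  rw [WithPiTopology.summable_iff_summable_coeff]
  intro m
  refine summable_of_hasFiniteSupport ((h (m .q + 1)).subset ?_)
  intro i hi hdvd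
  exact hi (coeff_eq_zero_of_q_pow_dvd hdvd (Nat.lt_succ_self _))

theorem summable_of_q_pow_dvd {f : ℕ → Series} (h : ∀ k, q ^ k ∣ f k) : Summable f := by
  refine summable_of_finite_not_q_pow_dvd fun N => (Set.finite_lt_nat N).subset ?_
  intro k hk
  by_contra hlt
  exact hk ((pow_dvd_pow q (not_lt.1 hlt)).trans (h k))

theorem q_pow_dvd_of_hasSum {ι : Type*} {f : ι → Series} {s : Series} {N : ℕ} (hs : HasSum f s)
    (h : ∀ i, q ^ N ∣ f i) : q ^ N ∣ s := by
  refine X_pow_dvd_iff.2 fun m hm => ?_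
  have h1 := WithPiTopology.hasSum_iff_hasSum_coeff.1 hs m
  have h2 : (fun i => coeff m (f i)) = fun _ => 0 :=
    funext fun i => coeff_eq_zero_of_q_pow_dvd (h i) hm
  rw [h2] at h1
  exact h1.unique hasSum_zero

theorem tendsto_zero_of_q_pow_dvd {f : ℕ → Series} (h : ∀ k, q ^ k ∣ f k) :
    Tendsto f atTop (𝓝 0) :=
  (summable_of_q_pow_dvd h).tendsto_atTop_zero

theorem constantCoeff_q : constantCoeff q = 0 := constantCoeff_X _

theorem constantCoeff_eq_zero_of_q_dvd {x : Series} (hx : q ∣ x) : constantCoeff x = 0 := by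
  obtain ⟨y, rfl⟩ := hx
  rw [map_mul, constantCoeff_q, zero_mul]

theorem q_pow_dvd_mul_pow {x p : Series} (hx : q ∣ x) (hp : q ∣ p) (k : ℕ) :
    q ^ (k + 1) ∣ x * p ^ k := by
  rw [pow_succ']
  exact mul_dvd_mul hx (pow_dvd_pow_of_dvd hp k)

theorem constantCoeff_qPoch {x : Series} (hx : q ∣ x) (p : Series) (n : ℕ) :
    constantCoeff (qPoch x p n) = 1 := by
  simp [qPoch, map_prod, constantCoeff_eq_zero_of_q_dvd hx]

theorem qPoch_mul_inv {x : Series} (hx : q ∣ x) (p : Series) (n : ℕ) :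
    qPoch x p n * (qPoch x p n)⁻¹ = 1 :=
  MvPowerSeries.mul_inv_cancel _ (by rw [constantCoeff_qPoch hx]; exact one_ne_zero)

theorem qPoch_succ {R : Type*} [CommRing R] (x p : R) (n : ℕ) :
    qPoch x p (n + 1) = qPoch x p n * (1 - x * p ^ n) :=
  Finset.prod_range_succ _ _

theorem multipliable_qPoch {x p : Series} (hx : q ∣ x) (hp : q ∣ p) :
    Multipliable fun k : ℕ => 1 - x * p ^ k := by
  simp_rw [sub_eq_add_neg]
  refine WithPiTopology.multipliable_one_add_of_tendsto_order_atTop_nhds_top ?_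
  refine ENat.tendsto_nhds_top_iff_natCast_lt.2 fun n => ?_
  filter_upwards [eventually_ge_atTop n] with k hk
  refine lt_of_lt_of_le (b := ((n + 1 : ℕ) : ℕ∞)) (by exact_mod_cast Nat.lt_succ_self n) ?_
  refine nat_le_order fun m hm => ?_
  -- The `q`-exponent of a monomial is at most its total degree, so divisibility by a power of `q`
  -- bounds the order from below.
  refine coeff_eq_zero_of_q_pow_dvd (N := n + 1) ?_ (lt_of_le_of_lt (Finsupp.le_degree _ m) hm)
  rw [dvd_neg]
  exact (pow_dvd_pow q (by lia)).trans (q_pow_dvd_mul_pow hx hp k)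

/-! ### Euler's expansion of `(x; p)_∞` -/

/-- The terms of Euler's series for `(x; p)_∞`. -/
noncomputable def eulerTerm (x p : Series) (k : ℕ) : Series :=
  (-x) ^ k * p ^ k.choose 2 * (qPoch p p k)⁻¹

theorem q_pow_dvd_eulerTerm {x : Series} {N : ℕ} (hx : q ^ N ∣ x) (p : Series) (k : ℕ) :
    q ^ (N * k) ∣ eulerTerm x p k := by
  rw [eulerTerm, mul_assoc, pow_mul]
  exact (pow_dvd_pow_of_dvd (by rwa [dvd_neg]) k).mul_right _

theorem summable_eulerTerm {x : Series} (hx : q ∣ x) (p : Series) : Summable (eulerTerm x p) :=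
  summable_of_q_pow_dvd fun k => by
    simpa using q_pow_dvd_eulerTerm (N := 1) (by simpa using hx) p k

/-- The factor 1 - p^(k+1) from x^(k+1) - (xp)^(k+1) cancels the last factor of (p;p)_(k+1). Summed
over k, this is the functional equation E(x) = (1 - x) E(xp); iterating it, with E(xp^n) → 1, gives
Euler's expansion. -/
theorem eulerTerm_succ_sub {p : Series} (hp : q ∣ p) (x : Series) (k : ℕ) :
    eulerTerm x p (k + 1) - eulerTerm (x * p) p (k + 1) = -x * eulerTerm (x * p) p k := by
  have h1 := qPoch_mul_inv hp p k
  have h2 := qPoch_mul_inv hp p (k + 1)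
  have h3 : (1 - p * p ^ k) * (qPoch p p (k + 1))⁻¹ = (qPoch p p k)⁻¹ := by
    rw [qPoch_succ] at h2 ⊢
    linear_combination (qPoch p p k)⁻¹ * h2 -
      (1 - p * p ^ k) * (qPoch p p k * (1 - p * p ^ k))⁻¹ * h1
  simp only [eulerTerm]
  rw [← h3, Nat.choose_succ_succ' k 1, Nat.choose_one_right, pow_add, neg_pow, neg_pow (x * p),
    neg_pow (x * p), mul_pow, mul_pow]
  ring

theorem tsum_eulerTerm_eq {x p : Series} (hx : q ∣ x) (hp : q ∣ p) :
    ∑' k, eulerTerm x p k = (1 - x) * ∑' k, eulerTerm (x * p) p k := by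
  have hxp : q ∣ x * p := hx.mul_right p
  have hS := summable_eulerTerm hx p
  have hS' := summable_eulerTerm hxp p
  have h0 : eulerTerm x p 0 = eulerTerm (x * p) p 0 := by simp [eulerTerm]
  have h : ∑' k, (eulerTerm x p k - eulerTerm (x * p) p k) =
      -x * ∑' k, eulerTerm (x * p) p k := by
    rw [(hS.sub hS').tsum_eq_zero_add, h0, sub_self, zero_add]
    simp_rw [eulerTerm_succ_sub hp]
    exact hS'.tsum_mul_left _
  rw [hS.tsum_sub hS'] at h
  linear_combination h

theorem tsum_eulerTerm_eq_qPoch_mul {x p : Series} (hx : q ∣ x) (hp : q ∣ p) (n : ℕ) :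
    ∑' k, eulerTerm x p k = qPoch x p n * ∑' k, eulerTerm (x * p ^ n) p k := by
  induction n with
  | zero => simp [qPoch]
  | succ n ih =>
    rw [ih, tsum_eulerTerm_eq (hx.mul_right _) hp, qPoch_succ]
    ring_nf

theorem tsum_eulerTerm_mul_pow_tendsto {x p : Series} (hx : q ∣ x) (hp : q ∣ p) :
    Tendsto (fun n => ∑' k, eulerTerm (x * p ^ n) p k) atTop (𝓝 1) := by
  have h : ∀ n, q ^ n ∣ ∑' k, eulerTerm (x * p ^ n) p k - 1 := by
    intro n
    have hS := summable_eulerTerm (hx.mul_right (p ^ n)) p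
    have h0 : eulerTerm (x * p ^ n) p 0 = 1 := by
      simp [eulerTerm, qPoch]
    rw [hS.tsum_eq_zero_add, h0, add_sub_cancel_left]
    refine q_pow_dvd_of_hasSum ((summable_nat_add_iff 1).2 hS).hasSum fun k => ?_
    have := q_pow_dvd_eulerTerm (q_pow_dvd_mul_pow hx hp n) p (k + 1)
    exact (pow_dvd_pow q (by nlinarith)).trans this
  have := (tendsto_zero_of_q_pow_dvd h).add_const 1
  simpa using this

theorem hasSum_eulerTerm {x p : Series} (hx : q ∣ x) (hp : q ∣ p) :
    HasSum (eulerTerm x p) (qPochInf x p) := by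
  have h1 : Tendsto (qPoch x p) atTop (𝓝 (qPochInf x p)) :=
    (multipliable_qPoch hx hp).hasProd.tendsto_prod_nat
  have h2 := h1.mul (tsum_eulerTerm_mul_pow_tendsto hx hp)
  simp_rw [← tsum_eulerTerm_eq_qPoch_mul hx hp] at h2
  rw [mul_one] at h2
  rw [← tendsto_nhds_unique tendsto_const_nhds h2]
  exact (summable_eulerTerm hx p).hasSum

theorem qPochInf_eq_qPoch_mul {x p : Series} (hx : q ∣ x) (hp : q ∣ p) (n : ℕ) :
    qPochInf x p = qPoch x p n * qPochInf (x * p ^ n) p := by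
  rw [← (hasSum_eulerTerm hx hp).tsum_eq, tsum_eulerTerm_eq_qPoch_mul hx hp n,
    (hasSum_eulerTerm (hx.mul_right _) hp).tsum_eq]

theorem constantCoeff_qPochInf {x p : Series} (hx : q ∣ x) (hp : q ∣ p) :
    constantCoeff (qPochInf x p) = 1 := by
  have h1 : Tendsto (qPoch x p) atTop (𝓝 (qPochInf x p)) :=
    (multipliable_qPoch hx hp).hasProd.tendsto_prod_nat
  have h2 := ((WithPiTopology.continuous_constantCoeff (σ := Var) ℚ).tendsto _).comp h1
  refine tendsto_nhds_unique h2 ?_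
  refine tendsto_const_nhds.congr fun n => ?_
  rw [Function.comp, constantCoeff_qPoch hx]

/-! ### Levelled parts

A part without overline is written as a level and a color, the size of the part being its level,
increased by one if the color is `b`. In terms of levels the difference conditions say that the
levels are weakly decreasing, and strictly decreasing for the color pairs with `gap` one. -/

/-- A part without overline, given by its level and its color. -/
structure LevelPart where
  level : ℕ
  color : Color
  deriving DecidableEq

/-- One for the color `b` and zero for the others. -/
def Color.offset : Color → ℕ
  | .a => 0
  | .b => 1
  | .u => 0

/-- The minimal difference of the levels of successive parts of the given colors. -/
def Color.gap : Color → Color → ℕ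
  | .a, .a => 1
  | .a, .b => 0
  | .a, .u => 1
  | .b, .a => 0
  | .b, .b => 1
  | .b, .u => 1
  | .u, _ => 0

namespace LevelPart

/-- The integer that a levelled part represents. -/
def size (x : LevelPart) : ℕ := x.level + x.color.offset

/-- The difference condition between a part `x` and the next part `y`. -/
def Precedes (x y : LevelPart) : Prop := x.color.gap y.color + y.level ≤ x.level

theorem Precedes.level_le {x y : LevelPart} (h : x.Precedes y) : y.level ≤ x.level :=
  le_of_add_le_right h

/-- Raise the level by one. -/
def raise (x : LevelPart) : LevelPart := ⟨x.level + 1, x.color⟩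

theorem raise_injective : Function.Injective raise := by
  rintro ⟨n, c⟩ ⟨n', c'⟩ h
  simpa [raise] using h

end LevelPart

/-- The number of parts of color `c`. -/
def colorCount (c : Color) (L : List LevelPart) : ℕ := L.countP fun x => x.color = c

/-- The sum of the sizes. -/
def totalSize (L : List LevelPart) : ℕ := (L.map LevelPart.size).sum

theorem colorCount_cons (c : Color) (x : LevelPart) (L : List LevelPart) :
    colorCount c (x :: L) = colorCount c L + if x.color = c then 1 else 0 := by
  simp [colorCount, List.countP_cons]

theorem colorCount_map_raise (c : Color) (L : List LevelPart) :
    colorCount c (L.map LevelPart.raise) = colorCount c L := by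
  rw [colorCount, List.countP_map]
  rfl

theorem length_eq_colorCount (L : List LevelPart) :
    L.length = colorCount .a L + colorCount .b L + colorCount .u L := by
  induction L with
  | nil => rfl
  | cons x L ih =>
    obtain ⟨n, c⟩ := x
    cases c <;> simp [colorCount_cons, ih] <;> lia

theorem totalSize_cons (x : LevelPart) (L : List LevelPart) :
    totalSize (x :: L) = x.size + totalSize L := by
  simp [totalSize]

theorem totalSize_map_raise (L : List LevelPart) :
    totalSize (L.map LevelPart.raise) = L.length + totalSize L := by
  induction L with
  | nil => rfl
  | cons x L ih =>
    simp only [List.map_cons, totalSize_cons, ih, List.length_cons, LevelPart.raise,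
      LevelPart.size]
    lia

/-- The length has to be fixed: `u` at level zero has size zero and may be repeated at will. -/
theorem finite_totalSize_lt (s N : ℕ) :
    {L : List LevelPart | L.length = s ∧ totalSize L < N}.Finite := by
  have hcol : (Set.univ : Set Color).Finite :=
    Set.Finite.subset (Set.toFinite {Color.a, Color.b, Color.u}) fun c _ => by
      cases c <;> simp
  have hP : {x : LevelPart | x.level < N}.Finite := by
    refine (((Set.finite_lt_nat N).prod hcol).image fun p => LevelPart.mk p.1 p.2).subset ?_
    intro x hx
    exact ⟨(x.level, x.color), ⟨hx, trivial⟩, rfl⟩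
  have hfin : Finite {x : LevelPart // x.level < N} := hP
  refine ((List.finite_length_eq {x : LevelPart // x.level < N} s).image
    (List.map Subtype.val)).subset ?_
  rintro L ⟨hs, hN⟩
  have hlt : ∀ x ∈ L, x.level < N := by
    intro x hx
    have := List.single_le_sum (l := L.map LevelPart.size) (by simp) x.size
      (List.mem_map_of_mem hx)
    exact lt_of_le_of_lt (le_trans (Nat.le_add_right _ _) this) hN
  refine ⟨L.attach.map fun x => ⟨x.1, hlt x.1 x.2⟩, by simpa using hs, ?_⟩
  simp [List.map_map, Function.comp_def]

/-- The generating series of a set of lists with respect to the total size. -/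
noncomputable def sizeSeries (S : Set (List LevelPart)) : Series :=
  ∑' L : S, q ^ totalSize (L : List LevelPart)

theorem summable_sizeSeries {S : Set (List LevelPart)} {s : ℕ} (h : ∀ L ∈ S, L.length = s) :
    Summable fun L : S => q ^ totalSize (L : List LevelPart) := by
  refine summable_of_finite_not_q_pow_dvd fun N => ?_
  refine Set.Finite.of_finite_image (f := Subtype.val) ?_ Subtype.val_injective.injOn
  refine (finite_totalSize_lt s N).subset ?_
  rintro _ ⟨⟨L, hL⟩, hdvd, rfl⟩
  refine ⟨h L hL, ?_⟩
  by_contra hlt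
  exact hdvd (pow_dvd_pow q (not_lt.1 hlt))

theorem sizeSeries_union {S T : Set (List LevelPart)} {s : ℕ} (hST : Disjoint S T)
    (hS : ∀ L ∈ S, L.length = s) (hT : ∀ L ∈ T, L.length = s) :
    sizeSeries (S ∪ T) = sizeSeries S + sizeSeries T :=
  (summable_sizeSeries hS).tsum_union_disjoint (f := fun L => q ^ totalSize L) hST
    (summable_sizeSeries hT)

theorem sizeSeries_image {S : Set (List LevelPart)} {s e : ℕ} (hS : ∀ L ∈ S, L.length = s)
    {g : List LevelPart → List LevelPart} (hg : Function.Injective g)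
    (hsize : ∀ L ∈ S, totalSize (g L) = e + totalSize L) :
    sizeSeries (g '' S) = q ^ e * sizeSeries S := by
  rw [sizeSeries, tsum_image (fun L => q ^ totalSize L) hg.injOn, sizeSeries,
    ← (summable_sizeSeries hS).tsum_mul_left]
  exact tsum_congr fun L => by rw [hsize L L.2, pow_add]

/-! ### Chains, read from the last part to the first -/

/-- The lists of `i` parts of color `a`, `j` of color `b` and `k` of color `u` that satisfy the
difference conditions when read backwards. -/
def chains (i j k : ℕ) : Set (List LevelPart) :=
  {L | L.IsChain (fun y x => x.Precedes y) ∧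
    colorCount .a L = i ∧ colorCount .b L = j ∧ colorCount .u L = k}

/-- The chains which start with neither `a` nor `b` at level zero. -/
def chainsFree (i j k : ℕ) : Set (List LevelPart) :=
  {L | L ∈ chains i j k ∧ ∀ x ∈ L.head?, x ≠ ⟨0, .a⟩ ∧ x ≠ ⟨0, .b⟩}

/-- The chains which start with `x`. -/
def chainsFrom (x : LevelPart) (i j k : ℕ) : Set (List LevelPart) :=
  {L | L ∈ chains i j k ∧ L.head? = some x}

theorem length_of_mem_chains {i j k : ℕ} {L : List LevelPart} (h : L ∈ chains i j k) :
    L.length = i + j + k := by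
  rw [length_eq_colorCount, h.2.1, h.2.2.1, h.2.2.2]

theorem length_of_mem_chainsFree {i j k : ℕ} : ∀ L ∈ chainsFree i j k, L.length = i + j + k :=
  fun _ h => length_of_mem_chains h.1

theorem length_of_mem_chainsFrom {x : LevelPart} {i j k : ℕ} :
    ∀ L ∈ chainsFrom x i j k, L.length = i + j + k :=
  fun _ h => length_of_mem_chains h.1

theorem chains_eq_union (i j k : ℕ) :
    chains i j k = chainsFree i j k ∪ chainsFrom ⟨0, .a⟩ i j k ∪ chainsFrom ⟨0, .b⟩ i j k := by
  ext L
  simp only [chainsFree, chainsFrom, Set.mem_union, Set.mem_ofPred_eq]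
  cases L with
  | nil => simp
  | cons x L => simp; tauto

theorem disjoint_chainsFree_chainsFrom_a (i j k : ℕ) :
    Disjoint (chainsFree i j k) (chainsFrom ⟨0, .a⟩ i j k) :=
  Set.disjoint_left.2 fun _ h h' => (h.2 _ h'.2).1 rfl

theorem disjoint_chainsFree_chainsFrom_b (i j k : ℕ) :
    Disjoint (chainsFree i j k) (chainsFrom ⟨0, .b⟩ i j k) :=
  Set.disjoint_left.2 fun _ h h' => (h.2 _ h'.2).2 rfl

theorem disjoint_chainsFrom (i j k : ℕ) :
    Disjoint (chainsFrom ⟨0, .a⟩ i j k) (chainsFrom ⟨0, .b⟩ i j k) :=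
  Set.disjoint_left.2 fun _ h h' => by simpa using h.2.symm.trans h'.2

theorem sizeSeries_chains (i j k : ℕ) :
    sizeSeries (chains i j k) = sizeSeries (chainsFree i j k) +
      sizeSeries (chainsFrom ⟨0, .a⟩ i j k) + sizeSeries (chainsFrom ⟨0, .b⟩ i j k) := by
  rw [chains_eq_union, sizeSeries_union (s := i + j + k), sizeSeries_union (s := i + j + k)]
  · exact disjoint_chainsFree_chainsFrom_a i j k
  · exact length_of_mem_chainsFree
  · exact length_of_mem_chainsFrom
  · exact Set.disjoint_union_left.2
      ⟨disjoint_chainsFree_chainsFrom_b i j k, disjoint_chainsFrom i j k⟩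
  · rintro L (h | h)
    exacts [length_of_mem_chainsFree L h, length_of_mem_chainsFrom L h]
  · exact length_of_mem_chainsFrom

theorem chainsFrom_a_zero (j k : ℕ) : chainsFrom ⟨0, .a⟩ 0 j k = ∅ := by
  refine Set.eq_empty_of_forall_notMem ?_
  rintro (_ | ⟨x, L⟩) ⟨⟨-, h, -⟩, hx⟩
  · simp at hx
  · obtain rfl : x = ⟨0, .a⟩ := by simpa using hx
    simp [colorCount_cons] at h

theorem chainsFrom_b_zero (i k : ℕ) : chainsFrom ⟨0, .b⟩ i 0 k = ∅ := by
  refine Set.eq_empty_of_forall_notMem ?_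
  rintro (_ | ⟨x, L⟩) ⟨⟨-, -, h, -⟩, hx⟩
  · simp at hx
  · obtain rfl : x = ⟨0, .b⟩ := by simpa using hx
    simp [colorCount_cons] at h

theorem cons_mem_chains {x : LevelPart} {L : List LevelPart} {i j k : ℕ} :
    x :: L ∈ chains i j k ↔ (∀ y ∈ L.head?, y.Precedes x) ∧
      L.IsChain (fun y x => x.Precedes y) ∧ colorCount .a (x :: L) = i ∧
      colorCount .b (x :: L) = j ∧ colorCount .u (x :: L) = k := by
  simp [chains, List.isChain_cons, and_assoc]

theorem precedes_zero_a {y : LevelPart} : y.Precedes ⟨0, .a⟩ ↔ y ≠ ⟨0, .a⟩ := by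
  obtain ⟨n, c⟩ := y
  cases c <;> simp [LevelPart.Precedes, Color.gap] ; lia

theorem precedes_zero_b {y : LevelPart} : y.Precedes ⟨0, .b⟩ ↔ y ≠ ⟨0, .b⟩ := by
  obtain ⟨n, c⟩ := y
  cases c <;> simp [LevelPart.Precedes, Color.gap] ; lia

theorem precedes_zero_u {y : LevelPart} :
    y.Precedes ⟨0, .u⟩ ↔ y ≠ ⟨0, .a⟩ ∧ y ≠ ⟨0, .b⟩ := by
  obtain ⟨n, c⟩ := y
  cases c <;> simp [LevelPart.Precedes, Color.gap] <;> lia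

/-- The chains which do not start with `a` at level zero. -/
def chainsAdmissible (i j k : ℕ) : Set (List LevelPart) :=
  {L | L ∈ chains i j k ∧ ∀ x ∈ L.head?, x ≠ ⟨0, .a⟩}

theorem chainsAdmissible_eq (i j k : ℕ) :
    chainsAdmissible i j k = chainsFree i j k ∪ chainsFrom ⟨0, .b⟩ i j k := by
  ext L
  simp only [chainsAdmissible, chainsFree, chainsFrom, Set.mem_union, Set.mem_ofPred_eq,
    ← and_or_left]
  refine and_congr_right fun _ => ?_
  cases L with
  | nil => simp
  | cons y L =>
    simp only [List.head?_cons, Option.mem_def, Option.some.injEq, forall_eq']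
    refine ⟨fun h => ?_, ?_⟩
    · tauto
    · rintro (h | rfl)
      exacts [h.1, by simp]

/-- By `precedes_zero_a`, the only head that cannot follow `a` at level zero (reading backwards) is
another such part. The cases `b` and `u` are alike, `u` excluding both `a` and `b` at level zero. -/
theorem chainsFrom_a_succ (i j k : ℕ) : chainsFrom ⟨0, .a⟩ (i + 1) j k =
    List.cons ⟨0, .a⟩ '' (chainsFree i j k ∪ chainsFrom ⟨0, .b⟩ i j k) := by
  rw [← chainsAdmissible_eq]
  ext L
  cases L with
  | nil => simp [chainsFrom]
  | cons x L =>
    simp only [Set.mem_image, List.cons.injEq]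
    constructor
    · rintro ⟨h, hx⟩
      obtain rfl : x = ⟨0, .a⟩ := by simpa using hx
      rw [cons_mem_chains] at h
      simp only [precedes_zero_a, colorCount_cons] at h
      simp at h
      exact ⟨L, ⟨⟨h.2.1, h.2.2⟩, h.1⟩, rfl, rfl⟩
    · rintro ⟨L', ⟨h, h'⟩, rfl, rfl⟩
      refine ⟨?_, rfl⟩
      rw [cons_mem_chains]
      simp only [precedes_zero_a, colorCount_cons]
      simpa using ⟨h', h⟩

theorem chainsFrom_b_succ (i j k : ℕ) : chainsFrom ⟨0, .b⟩ i (j + 1) k =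
    List.cons ⟨0, .b⟩ '' (chainsFree i j k ∪ chainsFrom ⟨0, .a⟩ i j k) := by
  have hset : chainsFree i j k ∪ chainsFrom ⟨0, .a⟩ i j k =
      {L | L ∈ chains i j k ∧ ∀ y ∈ L.head?, y ≠ ⟨0, .b⟩} := by
    ext L
    simp only [chainsFree, chainsFrom, Set.mem_union, Set.mem_ofPred_eq, ← and_or_left]
    refine and_congr_right fun _ => ?_
    cases L with
    | nil => simp
    | cons y L =>
      simp only [List.head?_cons, Option.mem_def, Option.some.injEq, forall_eq']
      refine ⟨?_, fun h => ?_⟩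
      · rintro (h | rfl)
        exacts [h.2, by simp]
      · tauto
  rw [hset]
  ext L
  cases L with
  | nil => simp [chainsFrom]
  | cons x L =>
    simp only [Set.mem_image, List.cons.injEq]
    constructor
    · rintro ⟨h, hx⟩
      obtain rfl : x = ⟨0, .b⟩ := by simpa using hx
      rw [cons_mem_chains] at h
      simp only [precedes_zero_b, colorCount_cons] at h
      simp at h
      exact ⟨L, ⟨⟨h.2.1, h.2.2⟩, h.1⟩, rfl, rfl⟩
    · rintro ⟨L', ⟨h, h'⟩, rfl, rfl⟩
      refine ⟨?_, rfl⟩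
      rw [cons_mem_chains]
      simp only [precedes_zero_b, colorCount_cons]
      simpa using ⟨h', h⟩

theorem chainsFrom_u_succ (i j k : ℕ) : chainsFrom ⟨0, .u⟩ i j (k + 1) =
    List.cons ⟨0, .u⟩ '' chainsFree i j k := by
  ext L
  cases L with
  | nil => simp [chainsFrom]
  | cons x L =>
    simp only [Set.mem_image, List.cons.injEq]
    constructor
    · rintro ⟨h, hx⟩
      obtain rfl : x = ⟨0, .u⟩ := by simpa using hx
      rw [cons_mem_chains] at h
      simp only [precedes_zero_u, colorCount_cons] at h
      simp at h
      exact ⟨L, ⟨⟨h.2.1, h.2.2⟩, by simpa using h.1⟩, rfl, rfl⟩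
    · rintro ⟨L', ⟨h, h'⟩, rfl, rfl⟩
      refine ⟨?_, rfl⟩
      rw [cons_mem_chains]
      simp only [precedes_zero_u, colorCount_cons]
      simpa using ⟨by simpa using h', h⟩

theorem chainsFrom_u_zero (i j : ℕ) : chainsFrom ⟨0, .u⟩ i j 0 = ∅ := by
  refine Set.eq_empty_of_forall_notMem ?_
  rintro (_ | ⟨x, L⟩) ⟨⟨-, -, -, h⟩, hx⟩
  · simp at hx
  · obtain rfl : x = ⟨0, .u⟩ := by simpa using hx
    simp [colorCount_cons] at h

/-- Read backwards, levels weakly increase, so a head of positive level makes all levels positive;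
the conditions compare levels only and survive a common shift. -/
theorem raise_image_chains (i j k : ℕ) : List.map LevelPart.raise '' chains i j k =
    {L | L ∈ chains i j k ∧ ∀ x ∈ L.head?, 1 ≤ x.level} := by
  ext L
  constructor
  · rintro ⟨L, ⟨hc, ha, hb, hu⟩, rfl⟩
    refine ⟨⟨?_, ?_, ?_, ?_⟩, ?_⟩
    · rw [List.isChain_map]
      exact hc.imp fun y x h => by
        simp only [LevelPart.Precedes, LevelPart.raise] at h ⊢
        lia
    · rw [colorCount_map_raise, ha]
    · rw [colorCount_map_raise, hb]
    · rw [colorCount_map_raise, hu]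
    · cases L <;> simp [LevelPart.raise]
  · rintro ⟨⟨hc, ha, hb, hu⟩, hx⟩
    have hall : ∀ x ∈ L, 1 ≤ x.level := by
      have hle : L.IsChain fun y x => y.level ≤ x.level := hc.imp fun y x h => h.level_le
      have : IsTrans LevelPart fun y x => y.level ≤ x.level := ⟨fun _ _ _ => le_trans⟩
      cases L with
      | nil => simp
      | cons y L =>
        have hy : 1 ≤ y.level := hx y rfl
        have hp := (List.pairwise_cons.1 (List.isChain_iff_pairwise.1 hle)).1
        intro x hx
        rcases List.mem_cons.1 hx with rfl | h
        exacts [hy, hy.trans (hp x h)]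
    have hL : (L.map fun x => (⟨x.level - 1, x.color⟩ : LevelPart)).map LevelPart.raise = L := by
      rw [List.map_map]
      refine (List.map_congr_left fun x h => ?_).trans (List.map_id L)
      have := hall x h
      obtain ⟨n, c⟩ := x
      simp only [Function.comp, LevelPart.raise, id] at this ⊢
      congr 1
      lia
    refine ⟨_, ⟨?_, ?_, ?_, ?_⟩, hL⟩
    · rw [← hL, List.isChain_map] at hc
      exact hc.imp fun y x h => by
        simp only [LevelPart.Precedes, LevelPart.raise] at h ⊢
        lia
    · rw [← colorCount_map_raise, hL, ha]
    · rw [← colorCount_map_raise, hL, hb]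
    · rw [← colorCount_map_raise, hL, hu]

theorem chainsFree_eq_union (i j k : ℕ) : chainsFree i j k =
    List.map LevelPart.raise '' chains i j k ∪ chainsFrom ⟨0, .u⟩ i j k := by
  rw [raise_image_chains]
  ext L
  simp only [chainsFree, chainsFrom, Set.mem_union, Set.mem_ofPred_eq, ← and_or_left]
  refine and_congr_right fun _ => ?_
  cases L with
  | nil => simp
  | cons x L =>
    obtain ⟨n, c⟩ := x
    cases c <;> simp <;> lia

/-! ### Recurrences for the generating series of chains -/

theorem sizeSeries_empty : sizeSeries ∅ = 0 := by
  simp [sizeSeries]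

theorem sizeSeries_chainsFrom_a_succ (i j k : ℕ) : sizeSeries (chainsFrom ⟨0, .a⟩ (i + 1) j k) =
    sizeSeries (chainsFree i j k) + sizeSeries (chainsFrom ⟨0, .b⟩ i j k) := by
  rw [chainsFrom_a_succ, sizeSeries_image (s := i + j + k) (e := 0) _ List.cons_injective,
    pow_zero, one_mul, sizeSeries_union (disjoint_chainsFree_chainsFrom_b i j k)
      length_of_mem_chainsFree length_of_mem_chainsFrom]
  · intro L _
    rw [totalSize_cons]; rfl
  · rintro L (h | h)
    exacts [length_of_mem_chainsFree L h, length_of_mem_chainsFrom L h]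

theorem sizeSeries_chainsFrom_b_succ (i j k : ℕ) : sizeSeries (chainsFrom ⟨0, .b⟩ i (j + 1) k) =
    q * (sizeSeries (chainsFree i j k) + sizeSeries (chainsFrom ⟨0, .a⟩ i j k)) := by
  rw [chainsFrom_b_succ, sizeSeries_image (s := i + j + k) (e := 1) _ List.cons_injective,
    pow_one, sizeSeries_union (disjoint_chainsFree_chainsFrom_a i j k)
      length_of_mem_chainsFree length_of_mem_chainsFrom]
  · intro L _
    rw [totalSize_cons]; rfl
  · rintro L (h | h)
    exacts [length_of_mem_chainsFree L h, length_of_mem_chainsFrom L h]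

theorem sizeSeries_chainsFrom_u_succ (i j k : ℕ) :
    sizeSeries (chainsFrom ⟨0, .u⟩ i j (k + 1)) = sizeSeries (chainsFree i j k) := by
  rw [chainsFrom_u_succ, sizeSeries_image (e := 0) length_of_mem_chainsFree List.cons_injective,
    pow_zero, one_mul]
  intro L _
  rw [totalSize_cons]; rfl

/-- A free head either has positive level, and lowering every part saves one unit per part, or is
`u` at level zero. -/
theorem sizeSeries_chainsFree (i j k : ℕ) : sizeSeries (chainsFree i j k) =
    q ^ (i + j + k) * sizeSeries (chains i j k) + sizeSeries (chainsFrom ⟨0, .u⟩ i j k) := by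
  rw [chainsFree_eq_union, sizeSeries_union (s := i + j + k),
    sizeSeries_image (s := i + j + k) (e := i + j + k) (fun _ => length_of_mem_chains)
      (List.map_injective_iff.2 LevelPart.raise_injective)]
  · intro L h
    rw [totalSize_map_raise, length_of_mem_chains h]
  · rw [raise_image_chains]
    refine Set.disjoint_left.2 fun L h h' => ?_
    simpa using h.2 _ h'.2
  · rw [raise_image_chains]
    exact fun L h => length_of_mem_chains h.1
  · exact length_of_mem_chainsFrom

theorem sizeSeries_chainsFree_zero : sizeSeries (chainsFree 0 0 0) = 1 := by
  have h : chainsFree 0 0 0 = {[]} := by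
    ext L
    constructor
    · exact fun h => List.length_eq_zero_iff.1 (length_of_mem_chainsFree L h)
    · rintro rfl
      exact ⟨⟨List.IsChain.nil, rfl, rfl, rfl⟩, by simp⟩
  rw [sizeSeries, h, tsum_singleton (β := List LevelPart) [] fun L => q ^ totalSize L]
  simp [totalSize]

/-! ### The generating series of chains in closed form -/

/-- The numerator of the generating series of chains, up to a power of `q`. -/
noncomputable def chainNum (i j : ℕ) : Series :=
  q ^ ((i + 1).choose 2 + (j + 1).choose 2) * qPoch (-q) q (i + j)

/-- The denominator of the generating series of chains, up to a power of `q`. -/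
noncomputable def chainDen (i j k : ℕ) : Series :=
  qPoch q q k * qPoch (q ^ 2) (q ^ 2) i * qPoch (q ^ 2) (q ^ 2) j

theorem chainNum_succ_left (i j : ℕ) :
    chainNum (i + 1) j = chainNum i j * q ^ (i + 1) * (1 + q ^ (i + j + 1)) := by
  rw [chainNum, chainNum, show i + 1 + j = i + j + 1 by ring, qPoch_succ,
    Nat.choose_succ_succ' (i + 1) 1, Nat.choose_one_right]
  ring

theorem chainNum_succ_right (i j : ℕ) :
    chainNum i (j + 1) = chainNum i j * q ^ (j + 1) * (1 + q ^ (i + j + 1)) := by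
  rw [chainNum, chainNum, ← add_assoc i j 1, qPoch_succ,
    Nat.choose_succ_succ' (j + 1) 1, Nat.choose_one_right]
  ring

theorem chainDen_succ_left (i j k : ℕ) :
    chainDen (i + 1) j k = chainDen i j k * (1 - q ^ (2 * (i + 1))) := by
  rw [chainDen, chainDen, qPoch_succ _ _ i]
  ring

theorem chainDen_succ_middle (i j k : ℕ) :
    chainDen i (j + 1) k = chainDen i j k * (1 - q ^ (2 * (j + 1))) := by
  rw [chainDen, chainDen, qPoch_succ _ _ j]
  ring

theorem chainDen_succ_right (i j k : ℕ) :
    chainDen i j (k + 1) = chainDen i j k * (1 - q ^ (k + 1)) := by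
  rw [chainDen, chainDen, qPoch_succ _ _ k]
  ring

theorem one_add_q_pow_ne_zero (n : ℕ) : (1 + q ^ n : Series) ≠ 0 := by
  intro h
  have := congrArg constantCoeff h
  rcases n with _ | n
  · rw [pow_zero, map_add, map_one, map_zero] at this
    norm_num at this
  · simp [constantCoeff_q] at this

theorem one_sub_q_pow_succ_ne_zero (n : ℕ) : (1 - q ^ (n + 1) : Series) ≠ 0 := by
  intro h
  have := congrArg constantCoeff h
  simp [constantCoeff_q] at this

/-- Write F, A, B for the series of chains that are free, start with `a`, or start with `b` at level
zero, and N for the product in `sizeSeries_chainsAdmissible`. The form is chosen so that F + B = N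
and F + A = N q^(j-i), which are the combinations required to prepend `a` or `b`. Denominators are
cleared because the identities live in a power series ring. -/
theorem sizeSeries_closed_aux (s : ℕ) : ∀ i j k, i + j + k = s →
    sizeSeries (chainsFree i j k) * q ^ (i * j) * chainDen i j k * (1 + q ^ (i + j)) =
        chainNum i j * q ^ j * (q ^ i + q ^ j) ∧
    sizeSeries (chainsFrom ⟨0, .a⟩ i j k) * q ^ (i * j) * chainDen i j k * (1 + q ^ (i + j)) *
        q ^ i = chainNum i j * q ^ j * (1 - q ^ (2 * i)) ∧
    sizeSeries (chainsFrom ⟨0, .b⟩ i j k) * q ^ (i * j) * chainDen i j k * (1 + q ^ (i + j)) =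
        chainNum i j * (1 - q ^ (2 * j)) := by
  induction s with
  | zero =>
    rintro i j k h
    obtain ⟨rfl, rfl, rfl⟩ : i = 0 ∧ j = 0 ∧ k = 0 := by lia
    simp [sizeSeries_chainsFree_zero, chainsFrom_a_zero, chainsFrom_b_zero, sizeSeries_empty,
      chainNum, chainDen, qPoch]
  | succ s ih =>
    rintro i j k hs
    have hA : sizeSeries (chainsFrom ⟨0, .a⟩ i j k) * q ^ (i * j) * chainDen i j k *
        (1 + q ^ (i + j)) * q ^ i = chainNum i j * q ^ j * (1 - q ^ (2 * i)) := by
      cases i with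
      | zero => simp [chainsFrom_a_zero, sizeSeries_empty]
      | succ i =>
        obtain ⟨h1, -, h3⟩ := ih i j k (by lia)
        have h : (sizeSeries (chainsFree i j k) + sizeSeries (chainsFrom ⟨0, .b⟩ i j k)) *
            q ^ (i * j) * chainDen i j k = chainNum i j := by
          refine mul_right_cancel₀ (one_add_q_pow_ne_zero (i + j)) ?_
          linear_combination h1 + h3
        rw [sizeSeries_chainsFrom_a_succ, chainDen_succ_left, chainNum_succ_left]
        linear_combination q ^ j * (1 - q ^ (2 * (i + 1))) * (1 + q ^ (i + 1 + j)) *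
          q ^ (i + 1) * h
    have hB : sizeSeries (chainsFrom ⟨0, .b⟩ i j k) * q ^ (i * j) * chainDen i j k *
        (1 + q ^ (i + j)) = chainNum i j * (1 - q ^ (2 * j)) := by
      cases j with
      | zero => simp [chainsFrom_b_zero, sizeSeries_empty]
      | succ j =>
        obtain ⟨h1, h2, -⟩ := ih i j k (by lia)
        have h : (sizeSeries (chainsFree i j k) + sizeSeries (chainsFrom ⟨0, .a⟩ i j k)) *
            q ^ (i * j) * chainDen i j k * q ^ i = chainNum i j * q ^ j := by
          refine mul_right_cancel₀ (one_add_q_pow_ne_zero (i + j)) ?_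
          linear_combination q ^ i * h1 + h2
        rw [sizeSeries_chainsFrom_b_succ, chainDen_succ_middle, chainNum_succ_right]
        linear_combination q * (1 - q ^ (2 * (j + 1))) * (1 + q ^ (i + (j + 1))) * h
    refine ⟨?_, hA, hB⟩
    have hU : sizeSeries (chainsFrom ⟨0, .u⟩ i j k) * q ^ (i * j) * chainDen i j k *
        (1 + q ^ (i + j)) = (1 - q ^ k) * (chainNum i j * q ^ j * (q ^ i + q ^ j)) := by
      cases k with
      | zero => simp [chainsFrom_u_zero, sizeSeries_empty]
      | succ k =>
        obtain ⟨h1, -, -⟩ := ih i j k (by lia)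
        rw [sizeSeries_chainsFrom_u_succ, chainDen_succ_right]
        linear_combination (1 - q ^ (k + 1)) * h1
    have hrec := sizeSeries_chainsFree i j k
    rw [sizeSeries_chains] at hrec
    -- For length i + j + k = s + 1 the recurrence reads F (1 - q^(s+1)) = q^(s+1) (A + B) + U, with
    -- U the series of chains starting with `u` at level zero; the factor on the left is cancelled.
    refine mul_right_cancel₀ (one_sub_q_pow_succ_ne_zero s) ?_
    rw [← hs]
    linear_combination q ^ (i * j) * chainDen i j k * (1 + q ^ (i + j)) * hrec +
      q ^ (j + k) * hA + q ^ (i + j + k) * hB + hU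

theorem sizeSeries_chainsAdmissible (i j k : ℕ) :
    sizeSeries (chainsAdmissible i j k) * q ^ (i * j) * chainDen i j k = chainNum i j := by
  obtain ⟨h1, -, h3⟩ := sizeSeries_closed_aux _ i j k rfl
  rw [chainsAdmissible_eq, sizeSeries_union (disjoint_chainsFree_chainsFrom_b i j k)
    length_of_mem_chainsFree length_of_mem_chainsFrom]
  refine mul_right_cancel₀ (one_add_q_pow_ne_zero (i + j)) ?_
  linear_combination h1 + h3

/-! ### Removing the overlines -/

/-- The difference of offsets is absorbed by passing from sizes to levels, leaving `gap` and the
overline term. -/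
theorem minDiff_eq (x y : ColoredPart) : minDiff x y =
    x.color.gap y.color + x.color.offset - y.color.offset +
      if x.overlined = true then 1 else 0 := by
  obtain ⟨n, c, o⟩ := x
  obtain ⟨n', c', o'⟩ := y
  cases c <;> cases c' <;> cases o <;> rfl

/-- The level of a part, overlined or not. -/
def ColoredPart.level (x : ColoredPart) : ℤ := x.size - x.color.offset

theorem minDiff_le_iff (x y : ColoredPart) : minDiff x y ≤ (x.size : ℤ) - (y.size : ℤ) ↔
    x.color.gap y.color + y.level + (if x.overlined = true then 1 else 0) ≤ x.level := by
  rw [minDiff_eq, ColoredPart.level, ColoredPart.level]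
  constructor <;> intro h <;> linarith

/-- The difference conditions imply that only final occurrences are overlined. -/
theorem final_occurrence_of_difference {l : List ColoredPart}
    (h : l.IsChain fun x y => minDiff x y ≤ (x.size : ℤ) - (y.size : ℤ)) :
    l.Pairwise fun x y => x.overlined = true → ¬ (y.size = x.size ∧ y.color = x.color) := by
  -- Dropping `gap` makes the relation transitive; the full conditions are not, since `a`, `b`, `a`
  -- may share a level. Equal colored integers have equal levels, which `r` forbids after an
  -- overlined part.
  let r : ColoredPart → ColoredPart → Prop := fun x y =>
    y.level + (if x.overlined = true then 1 else 0) ≤ x.level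
  have hr : IsTrans ColoredPart r := ⟨fun x y z hxy hyz => by
    simp only [r] at hxy hyz ⊢
    split_ifs at hxy hyz ⊢ <;> lia⟩
  have hl : l.IsChain r := h.imp fun x y hxy => by
    rw [minDiff_le_iff] at hxy
    simp only [r]
    lia
  refine (List.isChain_iff_pairwise.1 hl).imp fun {x y} hxy hx ⟨hs, hc⟩ => ?_
  simp only [r, ColoredPart.level, hx, hs, hc] at hxy
  simp at hxy

/-- The number of overlined parts. -/
def overCount (bs : List Bool) : ℕ := bs.count true

/-- Overline the parts of a list according to a list of flags of the same length: each overline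
adds one to its part and to all previous parts. -/
def decorate : List LevelPart → List Bool → List ColoredPart
  | x :: L, o :: bs => ⟨x.size + overCount (o :: bs), x.color, o⟩ :: decorate L bs
  | _, _ => []

theorem overCount_cons (o : Bool) (bs : List Bool) :
    overCount (o :: bs) = overCount bs + if o = true then 1 else 0 := by
  cases o <;> simp [overCount]

theorem decorate_injective : ∀ {L L' : List LevelPart} {bs bs' : List Bool},
    L.length = bs.length → L'.length = bs'.length → decorate L bs = decorate L' bs' →
    L = L' ∧ bs = bs'
  | [], [], [], [], _, _, _ => ⟨rfl, rfl⟩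
  | [], _ :: _, [], _ :: _, _, _, h => by simp [decorate] at h
  | _ :: _, [], _ :: _, [], _, _, h => by simp [decorate] at h
  | x :: L, x' :: L', o :: bs, o' :: bs', hl, hl', h => by
    simp only [decorate, List.cons.injEq, ColoredPart.mk.injEq] at h
    obtain ⟨⟨hs, hc, ho⟩, ht⟩ := h
    obtain ⟨rfl, rfl⟩ := decorate_injective (by simpa using hl) (by simpa using hl') ht
    obtain ⟨n, c⟩ := x
    obtain ⟨n', c'⟩ := x'
    obtain rfl : c = c' := hc
    obtain rfl : o = o' := ho
    obtain rfl : n = n' := by simpa [LevelPart.size] using hs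
    exact ⟨rfl, rfl⟩

/-- The conditions on a list of levelled parts which make its decorations jagged
overpartitions. -/
def IsAdmissible (L : List LevelPart) : Prop :=
  L.IsChain LevelPart.Precedes ∧ ∀ x ∈ L.getLast?, x ≠ ⟨0, .a⟩

/-- The overline counts of successive parts differ by exactly the overline term of the minimal
difference, so the two cancel. -/
theorem decorate_difference : ∀ {L : List LevelPart} {bs : List Bool}, L.length = bs.length →
    ((decorate L bs).IsChain (fun x y => minDiff x y ≤ (x.size : ℤ) - (y.size : ℤ)) ↔
      L.IsChain LevelPart.Precedes)
  | [], [], _ => by simp [decorate]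
  | [x], [o], _ => by simp [decorate]
  | x :: y :: L, o :: o' :: bs, hl => by
    have ih := decorate_difference (L := y :: L) (bs := o' :: bs) (by simpa using hl)
    simp only [decorate] at ih ⊢
    rw [List.isChain_cons_cons, List.isChain_cons_cons, ih, minDiff_le_iff]
    refine and_congr_left fun _ => ?_
    simp only [ColoredPart.level, LevelPart.size, LevelPart.Precedes, overCount_cons o]
    split_ifs <;> push_cast <;> lia

/-- Without their overlines, 0_a and overlined 1_a are both `a` at level zero. 0_b and overlined 1_b
would need level -1, so they never arise. -/
theorem decorate_last_part : ∀ {L : List LevelPart} {bs : List Bool}, L.length = bs.length →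
    ((∀ x ∈ (decorate L bs).getLast?, x ∉
      ({⟨0, .a, false⟩, ⟨0, .b, false⟩, ⟨1, .a, true⟩, ⟨1, .b, true⟩} : Set ColoredPart)) ↔
      ∀ x ∈ L.getLast?, x ≠ ⟨0, .a⟩)
  | [], [], _ => by simp [decorate]
  | [⟨n, c⟩], [o], _ => by
    cases c <;> cases o <;>
      simp [decorate, LevelPart.size, Color.offset, overCount]
  | x :: y :: L, o :: o' :: bs, hl => by
    have ih := decorate_last_part (L := y :: L) (bs := o' :: bs) (by simpa using hl)
    simp only [decorate] at ih ⊢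
    rw [List.getLast?_cons_cons, List.getLast?_cons_cons, ih]

theorem decorate_pos : ∀ {L : List LevelPart} {bs : List Bool},
    ∀ x ∈ decorate L bs, x.overlined = true → 0 < x.size
  | [], _, x, hx => by simp [decorate] at hx
  | _ :: _, [], x, hx => by simp [decorate] at hx
  | y :: L, o :: bs, x, hx => by
    rw [decorate, List.mem_cons] at hx
    rcases hx with rfl | hx
    · rintro rfl
      simp [overCount]
    · exact decorate_pos x hx

theorem isJaggedOverpartition_decorate_iff {L : List LevelPart} {bs : List Bool}
    (hl : L.length = bs.length) : IsJaggedOverpartition (decorate L bs) ↔ IsAdmissible L :=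
  ⟨fun h => ⟨(decorate_difference hl).1 h.difference, (decorate_last_part hl).1 h.last_part⟩,
    fun h => ⟨decorate_pos, final_occurrence_of_difference ((decorate_difference hl).2 h.1),
      (decorate_last_part hl).2 h.2, (decorate_difference hl).2 h.1⟩⟩

theorem IsJaggedOverpartition.tail {x : ColoredPart} {l : List ColoredPart}
    (h : IsJaggedOverpartition (x :: l)) : IsJaggedOverpartition l where
  pos_of_overlined y hy := h.pos_of_overlined y (List.mem_cons_of_mem _ hy)
  final_occurrence := h.final_occurrence.of_cons
  last_part := by
    cases l with
    | nil => simp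
    | cons y l => simpa only [List.getLast?_cons_cons] using h.last_part
  difference := h.difference.tail

theorem exists_decorate_eq_cons {x : ColoredPart} {L : List LevelPart} {bs : List Bool}
    (hx : (overCount (x.overlined :: bs) : ℤ) ≤ x.level) :
    ∃ y : LevelPart, decorate (y :: L) (x.overlined :: bs) = x :: decorate L bs := by
  obtain ⟨n, c, o⟩ := x
  -- By `hx` the natural subtractions are not truncated.
  refine ⟨⟨n - c.offset - overCount (o :: bs), c⟩, ?_⟩
  simp only [ColoredPart.level] at hx
  simp only [decorate, LevelPart.size, List.cons.injEq, ColoredPart.mk.injEq, and_true]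
  lia

/-- Overlines can be removed if every level is at least the number of overlines from its part on.
The last part satisfies this by positivity and the excluded values; the difference conditions pass
it to earlier parts. -/
theorem IsJaggedOverpartition.exists_decorate : ∀ {l : List ColoredPart},
    IsJaggedOverpartition l → ∃ L bs, L.length = bs.length ∧ decorate L bs = l
  | [], _ => ⟨[], [], rfl, rfl⟩
  | [x], h => by
    have hx : (overCount [x.overlined] : ℤ) ≤ x.level := by
      have h1 := h.pos_of_overlined x (by simp)
      have h2 := h.last_part x (by simp)
      obtain ⟨n, c, o⟩ := x
      cases c <;> cases o <;> simp [ColoredPart.level, Color.offset, overCount] at h1 h2 ⊢ <;> lia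
    obtain ⟨y, hy⟩ := exists_decorate_eq_cons (L := []) hx
    exact ⟨_, _, rfl, hy⟩
  | x :: y :: l, h => by
    obtain ⟨_ | ⟨y', L⟩, _ | ⟨o, bs⟩, hl, he⟩ := h.tail.exists_decorate
    · simp [decorate] at he
    · simp at hl
    · simp at hl
    have hxy := (minDiff_le_iff x y).1 (List.isChain_cons_cons.1 h.difference).1
    have hy : (overCount (o :: bs) : ℤ) ≤ y.level := by
      rw [decorate, List.cons.injEq] at he
      rw [← he.1]
      simp only [ColoredPart.level, LevelPart.size]
      lia
    have hx : (overCount (x.overlined :: o :: bs) : ℤ) ≤ x.level := by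
      rw [overCount_cons]
      push_cast
      lia
    obtain ⟨x', hx'⟩ := exists_decorate_eq_cons (L := y' :: L) hx
    exact ⟨_, _, by simpa using hl, hx'.trans (by rw [he])⟩

/-! ### Statistics of decorated lists -/

/-- The amount by which overlining according to `bs` increases the total size. -/
def overSize : List Bool → ℕ
  | [] => 0
  | o :: bs => overCount (o :: bs) + overSize bs

theorem sum_size_decorate : ∀ {L : List LevelPart} {bs : List Bool}, L.length = bs.length →
    ((decorate L bs).map ColoredPart.size).sum = totalSize L + overSize bs
  | [], [], _ => rfl
  | x :: L, o :: bs, hl => by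
    have ih := sum_size_decorate (L := L) (bs := bs) (by simpa using hl)
    rw [decorate, List.map_cons, List.sum_cons, ih, totalSize_cons, overSize]
    lia

theorem map_color_decorate : ∀ {L : List LevelPart} {bs : List Bool}, L.length = bs.length →
    (decorate L bs).map ColoredPart.color = L.map LevelPart.color
  | [], [], _ => rfl
  | x :: L, o :: bs, hl => by
    simp [decorate, map_color_decorate (L := L) (bs := bs) (by simpa using hl)]

theorem map_overlined_decorate : ∀ {L : List LevelPart} {bs : List Bool},
    L.length = bs.length → (decorate L bs).map ColoredPart.overlined = bs
  | [], [], _ => rfl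
  | x :: L, o :: bs, hl => by
    simp [decorate, map_overlined_decorate (L := L) (bs := bs) (by simpa using hl)]

theorem countP_color_decorate {L : List LevelPart} {bs : List Bool} (hl : L.length = bs.length)
    (p : Color → Bool) :
    (decorate L bs).countP (fun x => p x.color) = L.countP fun x => p x.color := by
  have h := congrArg (List.countP p) (map_color_decorate hl)
  rwa [List.countP_map, List.countP_map] at h

theorem colorCount_decorate {L : List LevelPart} {bs : List Bool} (hl : L.length = bs.length)
    (c : Color) : (decorate L bs).countP (fun x => x.color = c) = colorCount c L :=
  countP_color_decorate hl fun c' => decide (c' = c)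

theorem countP_overlined_decorate {L : List LevelPart} {bs : List Bool}
    (hl : L.length = bs.length) :
    (decorate L bs).countP (fun x => x.overlined = false) = bs.count false := by
  conv_rhs => rw [← map_overlined_decorate hl, List.count, List.countP_map]
  refine List.countP_congr fun x _ => ?_
  simp

theorem numBU_decorate {L : List LevelPart} {bs : List Bool} (hl : L.length = bs.length) :
    numBU (decorate L bs) = colorCount .b L + colorCount .u L := by
  rw [numBU, countP_color_decorate hl fun c => decide (c = .b ∨ c = .u)]
  clear hl
  induction L with
  | nil => rfl
  | cons x L ih =>
    rw [List.countP_cons, ih, colorCount_cons, colorCount_cons]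
    obtain ⟨n, c⟩ := x
    cases c <;> simp <;> lia

theorem length_decorate {L : List LevelPart} {bs : List Bool} (hl : L.length = bs.length) :
    (decorate L bs).length = bs.length := by
  conv_rhs => rw [← map_overlined_decorate hl, List.length_map]

/-- The parts not of color `b` or `u` are those of color `a`, so exactly as many leading flags are
free. -/
theorem forall_mem_drop_decorate_iff {L : List LevelPart} {bs : List Bool}
    (hl : L.length = bs.length) :
    (∀ x ∈ (decorate L bs).drop ((decorate L bs).length - numBU (decorate L bs)),
      x.overlined = true) ↔ ∀ o ∈ bs.drop (colorCount .a L), o = true := by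
  have h : (decorate L bs).length - numBU (decorate L bs) = colorCount .a L := by
    rw [length_decorate hl, ← hl, length_eq_colorCount, numBU_decorate hl]
    lia
  rw [h]
  conv_rhs => rw [← map_overlined_decorate hl, ← List.map_drop]
  rw [List.forall_mem_map]

/-! ### Summation over the overlines -/

/-- The weight of a list of flags. -/
noncomputable def flagWeight (bs : List Bool) : Series := d ^ bs.count false * q ^ overSize bs

/-- A new last overline raises its own part and all earlier ones, so it counts its position. -/
theorem overSize_concat (bs : List Bool) (o : Bool) :
    overSize (bs ++ [o]) = overSize bs + if o = true then bs.length + 1 else 0 := by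
  induction bs with
  | nil => cases o <;> rfl
  | cons o' bs ih =>
    have h : overCount (bs ++ [o]) = overCount bs + if o = true then 1 else 0 := by
      cases o <;> simp [overCount]
    rw [List.cons_append, overSize, ih, overCount_cons, h, overSize, overCount_cons o' bs,
      List.length_cons]
    split_ifs <;> lia

theorem flagWeight_concat_true (bs : List Bool) :
    flagWeight (bs ++ [true]) = flagWeight bs * q ^ (bs.length + 1) := by
  simp [flagWeight, overSize_concat, pow_add, mul_assoc]

theorem flagWeight_concat_false (bs : List Bool) :
    flagWeight (bs ++ [false]) = flagWeight bs * d := by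
  simp [flagWeight, overSize_concat]
  ring

/-- The lists of `i + l` flags of which the last `l` are `true`. -/
def flags (i l : ℕ) : Set (List Bool) :=
  {bs | bs.length = i + l ∧ ∀ o ∈ bs.drop i, o = true}

theorem finite_flags (i l : ℕ) : (flags i l).Finite :=
  (List.finite_length_eq Bool (i + l)).subset fun _ h => h.1

theorem concat_injective (o : Bool) : Function.Injective fun bs : List Bool => bs ++ [o] :=
  fun _ _ h => List.append_cancel_right h

theorem flags_succ_right (i l : ℕ) : flags i (l + 1) = (· ++ [true]) '' flags i l := by
  ext bs
  constructor
  · rintro ⟨hl, ht⟩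
    rcases List.eq_nil_or_concat' bs with rfl | ⟨bs, o, rfl⟩
    · simp at hl
    · have hl' : bs.length = i + l := by simpa [← add_assoc] using hl
      rw [List.drop_append_of_le_length (by lia)] at ht
      obtain rfl : o = true := ht o (by simp)
      exact ⟨bs, ⟨hl', fun o ho => ht o (by simp [ho])⟩, rfl⟩
  · rintro ⟨bs, ⟨hl, ht⟩, rfl⟩
    refine ⟨by simp [hl, add_assoc], ?_⟩
    rw [List.drop_append_of_le_length (by lia)]
    intro o ho
    rcases List.mem_append.1 ho with h | h
    exacts [ht o h, by simpa using h]

theorem mem_flags_zero {i : ℕ} {bs : List Bool} : bs ∈ flags i 0 ↔ bs.length = i := by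
  refine ⟨fun h => h.1, fun h => ⟨h, ?_⟩⟩
  rw [List.drop_of_length_le h.le]
  simp

theorem flags_succ_left (i : ℕ) :
    flags (i + 1) 0 = (· ++ [true]) '' flags i 0 ∪ (· ++ [false]) '' flags i 0 := by
  ext bs
  simp only [Set.mem_union, Set.mem_image, mem_flags_zero]
  constructor
  · intro hl
    rcases List.eq_nil_or_concat' bs with rfl | ⟨bs, o, rfl⟩
    · simp at hl
    · have hl' : bs.length = i := by simpa using hl
      cases o
      exacts [Or.inr ⟨bs, hl', rfl⟩, Or.inl ⟨bs, hl', rfl⟩]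
  · rintro (⟨bs, rfl, rfl⟩ | ⟨bs, rfl, rfl⟩) <;> simp

theorem tsum_flagWeight_image {S : Set (List Bool)} {o : Bool} {w : Series} (hS : S.Finite)
    (h : ∀ bs ∈ S, flagWeight (bs ++ [o]) = flagWeight bs * w) :
    ∑' bs : ((· ++ [o]) '' S : Set (List Bool)), flagWeight bs =
      (∑' bs : S, flagWeight bs) * w := by
  have hs : Summable fun bs : S => flagWeight bs := hS.summable flagWeight
  rw [tsum_image flagWeight (concat_injective o).injOn, ← hs.tsum_mul_right]
  exact tsum_congr fun bs => h bs bs.2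

theorem tsum_flags_zero (i : ℕ) : ∑' bs : flags i 0, flagWeight bs = qPochScaled d (-q) q i := by
  induction i with
  | zero =>
    have h : flags 0 0 = {[]} := by
      ext bs
      rw [mem_flags_zero, List.length_eq_zero_iff, Set.mem_singleton_iff]
    rw [h, tsum_singleton (β := List Bool) [] flagWeight]
    simp [flagWeight, overSize, qPochScaled]
  | succ i ih =>
    have hdisj : Disjoint ((· ++ [true]) '' flags i 0) ((· ++ [false]) '' flags i 0) := by
      refine Set.disjoint_left.2 ?_
      rintro _ ⟨bs, -, rfl⟩ ⟨bs', -, h⟩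
      simp at h
    rw [flags_succ_left, (((finite_flags i 0).image _).summable flagWeight).tsum_union_disjoint
      hdisj (((finite_flags i 0).image _).summable flagWeight),
      tsum_flagWeight_image (w := q ^ (i + 1)) (finite_flags i 0),
      tsum_flagWeight_image (w := d) (finite_flags i 0), ih, qPochScaled, qPochScaled,
      Finset.prod_range_succ]
    · ring
    · exact fun bs _ => flagWeight_concat_false bs
    · intro bs hbs
      rw [flagWeight_concat_true, mem_flags_zero.1 hbs]

/-- The forced overlines occupy positions i + 1, …, i + l, whose sum is il + l(l+1)/2. -/
theorem tsum_flags (i l : ℕ) : ∑' bs : flags i l, flagWeight bs =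
    qPochScaled d (-q) q i * q ^ (i * l + (l + 1).choose 2) := by
  induction l with
  | zero => simp [tsum_flags_zero]
  | succ l ih =>
    rw [flags_succ_right, tsum_flagWeight_image (w := q ^ (i + l + 1)) (finite_flags i l), ih,
      Nat.choose_succ_succ' (l + 1) 1, Nat.choose_one_right]
    · ring
    · intro bs hbs
      rw [flagWeight_concat_true, hbs.1]

/-! ### The generating function as a sum over jagged overpartitions -/

theorem finite_overpartitions₂ (n k i j : ℕ) : (overpartitions₂ n k i j).Finite := by
  have hcol : (Set.univ : Set (Color × Bool)).Finite :=
    Set.Finite.subset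
      (Set.toFinite (({Color.a, Color.b, Color.u} : Set Color) ×ˢ (Set.univ : Set Bool)))
      fun c _ => by
        obtain ⟨c, o⟩ := c
        cases c <;> simp
  have hP : {x : ColoredPart | x.size ≤ n}.Finite := by
    refine (((Set.finite_le_nat n).prod hcol).image
      fun p => ColoredPart.mk p.1 p.2.1 p.2.2).subset ?_
    intro x hx
    exact ⟨(x.size, x.color, x.overlined), ⟨hx, trivial⟩, rfl⟩
  have hfin : Finite {x : ColoredPart // x.size ≤ n} := hP
  -- An overlined part is positive, so there are at most n of them, besides k others.
  refine ((List.finite_length_le {x : ColoredPart // x.size ≤ n} (n + k)).image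
    (List.map Subtype.val)).subset ?_
  rintro l ⟨⟨hJ, hn, hk, -, -⟩, -⟩
  have hle : ∀ x ∈ l, x.size ≤ n := by
    intro x hx
    rw [← hn]
    exact List.single_le_sum (by simp) x.size (List.mem_map_of_mem hx)
  have hlen : ∀ l : List ColoredPart, (∀ x ∈ l, x.overlined = true → 0 < x.size) →
      l.length ≤ (l.map ColoredPart.size).sum + l.countP (fun x => x.overlined = false) := by
    intro l
    induction l with
    | nil => simp
    | cons x l ih =>
      intro h
      have h1 := ih fun y hy => h y (List.mem_cons_of_mem _ hy)
      have h2 := h x List.mem_cons_self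
      have h3 : 1 ≤ x.size + if decide (x.overlined = false) = true then 1 else 0 := by
        cases hx : x.overlined
        · simp
        · exact Nat.le_add_right_of_le (h2 hx)
      rw [List.length_cons, List.map_cons, List.sum_cons, List.countP_cons]
      lia
  refine ⟨l.attach.map fun x => ⟨x.1, hle x.1 x.2⟩, ?_, by simp [List.map_map, Function.comp_def]⟩
  have := hlen l hJ.pos_of_overlined
  rw [hn, hk] at this
  simpa using this

/-- The jagged overpartitions counted by `C₂`, for all values of the statistics. -/
def jagged₂ : Set (List ColoredPart) :=
  {l | IsJaggedOverpartition l ∧ ∀ x ∈ l.drop (l.length - numBU l), x.overlined = true}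

/-- The monomial recording the statistics of a list of colored parts. -/
noncomputable def statMonomial (l : List ColoredPart) : Series :=
  a ^ l.countP (fun x => x.color = .a) * b ^ l.countP (fun x => x.color = .b) *
    d ^ l.countP (fun x => x.overlined = false) * q ^ (l.map ColoredPart.size).sum

theorem coeff_statMonomial (m : Var →₀ ℕ) (l : List ColoredPart) :
    coeff m (statMonomial l) =
      if (l.map ColoredPart.size).sum = m .q ∧ l.countP (fun x => x.overlined = false) = m .d ∧
        l.countP (fun x => x.color = .a) = m .a ∧ l.countP (fun x => x.color = .b) = m .b
      then 1 else 0 := by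
  simp only [statMonomial, a, b, d, q, X_pow_eq, monomial_mul_monomial, mul_one, coeff_monomial]
  refine if_congr ?_ rfl rfl
  constructor
  · rintro rfl
    simp
  · rintro ⟨h1, h2, h3, h4⟩
    rw [h1, h2, h3, h4]
    ext v
    cases v <;> simp

/-- Unconditional convergence over all lists is established here once; the later regroupings by
flags, chains and colors inherit it. -/
theorem hasSum_genFun : HasSum (jagged₂.indicator statMonomial) genFun := by
  classical
  rw [WithPiTopology.hasSum_iff_hasSum_coeff]
  intro m
  have hf := finite_overpartitions₂ (m .q) (m .d) (m .a) (m .b)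
  have hc : ∀ l, coeff m (jagged₂.indicator statMonomial l) =
      if l ∈ hf.toFinset then (1 : ℚ) else 0 := by
    intro l
    rw [Set.indicator_apply]
    split_ifs with h1 h2 h2
    · rw [hf.mem_toFinset] at h2
      rw [coeff_statMonomial, if_pos h2.1.2]
    · rw [hf.mem_toFinset] at h2
      rw [coeff_statMonomial, if_neg fun h => h2 ⟨⟨h1.1, h⟩, h1.2⟩]
    · rw [hf.mem_toFinset] at h2
      exact absurd ⟨h2.1.1, h2.2⟩ h1
    · exact map_zero _
  simp_rw [hc]
  have hsum := hasSum_sum_of_ne_finset_zero (f := fun l => if l ∈ hf.toFinset then (1 : ℚ) else 0)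
    (s := hf.toFinset) (L := .unconditional _) fun l hl => if_neg hl
  have hval : coeff m genFun = ∑ l ∈ hf.toFinset, if l ∈ hf.toFinset then (1 : ℚ) else 0 := by
    rw [Finset.sum_ite_mem, Finset.inter_self, Finset.sum_const, nsmul_one]
    change ((overpartitions₂ (m .q) (m .d) (m .a) (m .b)).ncard : ℚ) = _
    rw [Set.ncard_eq_toFinset_card _ hf]
  rw [hval]
  exact hsum

/-- Admissible chains, indexed by their color statistics. -/
abbrev ChainIndex : Type :=
  Σ c : ℕ × ℕ × ℕ, chainsAdmissible c.1 c.2.1 c.2.2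

/-- Admissible chains with a choice of overlines. -/
abbrev DecoratedIndex : Type :=
  Σ x : ChainIndex, flags x.1.1 (x.1.2.1 + x.1.2.2)

/-- The jagged overpartition given by an admissible chain and a choice of overlines. -/
def DecoratedIndex.toList (x : DecoratedIndex) : List ColoredPart :=
  decorate x.1.2.1.reverse x.2.1

theorem DecoratedIndex.length_eq (x : DecoratedIndex) :
    x.1.2.1.reverse.length = x.2.1.length := by
  rw [List.length_reverse, length_of_mem_chains x.1.2.2.1, x.2.2.1, add_assoc]

theorem colorCount_reverse (c : Color) (L : List LevelPart) :
    colorCount c L.reverse = colorCount c L := List.countP_reverse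

theorem isAdmissible_reverse_iff {L : List LevelPart} {i j k : ℕ} (hi : colorCount .a L = i)
    (hj : colorCount .b L = j) (hk : colorCount .u L = k) :
    IsAdmissible L.reverse ↔ L ∈ chainsAdmissible i j k := by
  rw [IsAdmissible, List.isChain_reverse, List.getLast?_reverse]
  simp only [chainsAdmissible, chains, Set.mem_ofPred_eq, hi, hj, hk, and_true]

theorem DecoratedIndex.toList_injective : Function.Injective DecoratedIndex.toList := by
  rintro x y h
  have hx := x.length_eq
  have hy := y.length_eq
  obtain ⟨⟨⟨i, j, k⟩, L, hL⟩, bs, hbs⟩ := x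
  obtain ⟨⟨⟨i', j', k'⟩, L', hL'⟩, bs', hbs'⟩ := y
  obtain ⟨h1, rfl⟩ := decorate_injective hx hy h
  obtain rfl : L = L' := List.reverse_injective h1
  obtain ⟨⟨-, hi, hj, hk⟩, -⟩ := id hL
  obtain ⟨⟨-, hi', hj', hk'⟩, -⟩ := id hL'
  simp only at hi hj hk hi' hj' hk'
  subst hi hj hk hi' hj' hk'
  rfl

theorem DecoratedIndex.range_toList : Set.range DecoratedIndex.toList = jagged₂ := by
  ext l
  constructor
  · rintro ⟨x, rfl⟩
    have hx := x.length_eq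
    obtain ⟨⟨⟨i, j, k⟩, L, hL⟩, bs, hbs⟩ := x
    obtain ⟨⟨-, hi, hj, hk⟩, -⟩ := id hL
    refine ⟨(isJaggedOverpartition_decorate_iff hx).2
      ((isAdmissible_reverse_iff hi hj hk).2 hL), ?_⟩
    refine (forall_mem_drop_decorate_iff hx).2 ?_
    rw [colorCount_reverse, hi]
    exact hbs.2
  · rintro ⟨hJ, hd⟩
    obtain ⟨L, bs, hl, rfl⟩ := hJ.exists_decorate
    have hL := (isJaggedOverpartition_decorate_iff hl).1 hJ
    have hd' := (forall_mem_drop_decorate_iff hl).1 hd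
    rw [← L.reverse_reverse] at hL
    refine ⟨⟨⟨(colorCount .a L, colorCount .b L, colorCount .u L), L.reverse,
      (isAdmissible_reverse_iff ?_ ?_ ?_).1 hL⟩, bs, ?_, hd'⟩, ?_⟩
    · exact colorCount_reverse _ _
    · exact colorCount_reverse _ _
    · exact colorCount_reverse _ _
    · rw [← hl, length_eq_colorCount, add_assoc]
    · simp [DecoratedIndex.toList]

theorem totalSize_reverse (L : List LevelPart) : totalSize L.reverse = totalSize L := by
  rw [totalSize, List.map_reverse, List.sum_reverse, totalSize]

theorem DecoratedIndex.statMonomial_toList (x : DecoratedIndex) : statMonomial x.toList =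
    a ^ x.1.1.1 * b ^ x.1.1.2.1 * q ^ totalSize x.1.2.1 * flagWeight x.2.1 := by
  have hx := x.length_eq
  obtain ⟨⟨⟨i, j, k⟩, L, hL⟩, bs, hbs⟩ := x
  obtain ⟨⟨-, hi, hj, hk⟩, -⟩ := id hL
  simp only [DecoratedIndex.toList, statMonomial] at hx ⊢
  rw [colorCount_decorate hx, colorCount_decorate hx, countP_overlined_decorate hx,
    sum_size_decorate hx, colorCount_reverse, colorCount_reverse, hi, hj, totalSize_reverse,
    flagWeight]
  ring

/-- The contribution of the jagged overpartitions with given color statistics. -/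
noncomputable def colorTerm (i j k : ℕ) : Series :=
  a ^ i * b ^ j * sizeSeries (chainsAdmissible i j k) *
    (qPochScaled d (-q) q i * q ^ (i * (j + k) + (j + k + 1).choose 2))

theorem hasSum_decoratedIndex : HasSum (fun x : DecoratedIndex =>
    a ^ x.1.1.1 * b ^ x.1.1.2.1 * q ^ totalSize x.1.2.1 * flagWeight x.2.1) genFun := by
  have h : HasSum (jagged₂.indicator statMonomial ∘ DecoratedIndex.toList) genFun := by
    refine (DecoratedIndex.toList_injective.hasSum_iff fun l hl => ?_).2 hasSum_genFun
    rw [DecoratedIndex.range_toList] at hl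
    exact Set.indicator_of_notMem hl _
  refine h.congr_fun fun x => ?_
  have hx : x.toList ∈ jagged₂ := by
    rw [← DecoratedIndex.range_toList]
    exact Set.mem_range_self x
  rw [Function.comp_apply, Set.indicator_of_mem hx, x.statMonomial_toList]

theorem hasSum_flags (i l : ℕ) : HasSum (fun bs : flags i l => flagWeight bs)
    (qPochScaled d (-q) q i * q ^ (i * l + (l + 1).choose 2)) := by
  rw [← tsum_flags]
  exact ((finite_flags i l).summable flagWeight).hasSum

theorem hasSum_chainIndex : HasSum (fun x : ChainIndex =>
    a ^ x.1.1 * b ^ x.1.2.1 * q ^ totalSize x.2.1 *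
      (qPochScaled d (-q) q x.1.1 * q ^ (x.1.1 * (x.1.2.1 + x.1.2.2) +
        (x.1.2.1 + x.1.2.2 + 1).choose 2))) genFun :=
  hasSum_decoratedIndex.sigma fun x =>
    (hasSum_flags x.1.1 (x.1.2.1 + x.1.2.2)).mul_left
      (a ^ x.1.1 * b ^ x.1.2.1 * q ^ totalSize x.2.1)

theorem hasSum_sizeSeries_mul (i j k : ℕ) (x y : Series) :
    HasSum (fun L : chainsAdmissible i j k => x * q ^ totalSize L.1 * y)
      (x * sizeSeries (chainsAdmissible i j k) * y) := by
  have h : HasSum (fun L : chainsAdmissible i j k => q ^ totalSize L.1)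
      (sizeSeries (chainsAdmissible i j k)) :=
    (summable_sizeSeries fun L hL => length_of_mem_chains hL.1).hasSum
  exact (h.mul_left x).mul_right y

theorem hasSum_colorTerm :
    HasSum (fun c : ℕ × ℕ × ℕ => colorTerm c.1 c.2.1 c.2.2) genFun := by
  refine hasSum_chainIndex.sigma fun c => ?_
  obtain ⟨i, j, k⟩ := c
  simp only [colorTerm]
  exact hasSum_sizeSeries_mul i j k _ _

/-! ### Summation over the colors -/

theorem choose_two_add (j k : ℕ) :
    (j + k + 1).choose 2 = (j + 1).choose 2 + (k + 1).choose 2 + j * k := by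
  induction k with
  | zero => simp
  | succ k ih =>
    rw [← add_assoc, Nat.choose_succ_succ' (j + k + 1) 1, ih, Nat.choose_succ_succ' (k + 1) 1,
      Nat.choose_one_right, Nat.choose_one_right]
    ring

/-- The flag exponent is i(j+k) + C(j+k+1,2). Its ij clears the power of q in the chain formula; ik
+ jk shifts Euler's series in k by i + j; and one C(j+1,2) from the flags with one from the chains
gives base q² in the series in j. -/
theorem colorTerm_eq (i j k : ℕ) : colorTerm i j k =
    summand i * eulerTerm (-(b * q ^ 2)) (q ^ 2) j *
      (qPoch (-q) q (i + j) * eulerTerm (-q * q ^ (i + j)) q k) := by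
  have hq2 : q ∣ q ^ 2 := dvd_pow_self q two_ne_zero
  have hk := qPoch_mul_inv dvd_rfl q k
  have hi := qPoch_mul_inv hq2 (q ^ 2) i
  have hj := qPoch_mul_inv hq2 (q ^ 2) j
  have h := sizeSeries_chainsAdmissible i j k
  have h' : sizeSeries (chainsAdmissible i j k) * q ^ (i * j) = chainNum i j *
      ((qPoch q q k)⁻¹ * (qPoch (q ^ 2) (q ^ 2) i)⁻¹ * (qPoch (q ^ 2) (q ^ 2) j)⁻¹) := by
    have hD : chainDen i j k * ((qPoch q q k)⁻¹ * (qPoch (q ^ 2) (q ^ 2) i)⁻¹ *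
        (qPoch (q ^ 2) (q ^ 2) j)⁻¹) = 1 := by
      rw [chainDen]
      calc _ = (qPoch q q k * (qPoch q q k)⁻¹) *
            (qPoch (q ^ 2) (q ^ 2) i * (qPoch (q ^ 2) (q ^ 2) i)⁻¹) *
            (qPoch (q ^ 2) (q ^ 2) j * (qPoch (q ^ 2) (q ^ 2) j)⁻¹) := by ring
        _ = 1 := by rw [hk, hi, hj, one_mul, one_mul]
    rw [← h, mul_assoc _ (chainDen i j k), hD, mul_one]
  have hT : ∀ n : ℕ, (n + 1).choose 2 = n + n.choose 2 := fun n => by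
    rw [Nat.choose_succ_succ' n 1, Nat.choose_one_right]
  calc colorTerm i j k
      = a ^ i * b ^ j * (sizeSeries (chainsAdmissible i j k) * q ^ (i * j)) *
        qPochScaled d (-q) q i *
          q ^ (i * k + ((j + 1).choose 2 + (k + 1).choose 2 + j * k)) := by
        rw [colorTerm, choose_two_add]
        ring
    _ = _ := by
        rw [h', chainNum, summand, eulerTerm, eulerTerm, neg_neg, ← neg_mul, neg_neg, hT j, hT k]
        ring

/-- The sum does not depend on n, which is what decouples i from j. -/
theorem hasSum_eulerTerm_shift (n : ℕ) :
    HasSum (fun k => qPoch (-q) q n * eulerTerm (-q * q ^ n) q k) (qPochInf (-q) q) := by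
  have hq : q ∣ -q := (dvd_neg).2 dvd_rfl
  rw [qPochInf_eq_qPoch_mul hq dvd_rfl n]
  exact (hasSum_eulerTerm (hq.mul_right _) dvd_rfl).mul_left _

theorem hasSum_summand_mul : HasSum
    (fun i => summand i * qPochInf (-(b * q ^ 2)) (q ^ 2) * qPochInf (-q) q) genFun := by
  have hq2 : q ∣ q ^ 2 := dvd_pow_self q two_ne_zero
  have h : HasSum (fun c : (ℕ × ℕ) × ℕ => colorTerm c.1.1 c.1.2 c.2) genFun :=
    (Equiv.prodAssoc ℕ ℕ ℕ).hasSum_iff.2 hasSum_colorTerm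
  have h1 : HasSum (fun c : ℕ × ℕ => summand c.1 * eulerTerm (-(b * q ^ 2)) (q ^ 2) c.2 *
      qPochInf (-q) q) genFun := by
    refine h.prod_fiberwise fun c => ?_
    simp_rw [colorTerm_eq]
    exact (hasSum_eulerTerm_shift (c.1 + c.2)).mul_left _
  refine h1.prod_fiberwise fun i => ?_
  exact ((hasSum_eulerTerm ((dvd_neg).2 (hq2.mul_left b)) hq2).mul_left (summand i)).mul_right _

end Jagged

theorem mainTheorem2 :
    (∀ n k i j : ℕ, (Jagged.overpartitions₂ n k i j).Finite) ∧
    Multipliable (fun k : ℕ => 1 - (-Jagged.q) * Jagged.q ^ k) ∧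
    Multipliable (fun k : ℕ => 1 - (-(Jagged.b * Jagged.q ^ 2)) * (Jagged.q ^ 2) ^ k) ∧
    Summable Jagged.summand ∧
    Jagged.genFun =
      Jagged.qPochInf (-Jagged.q) Jagged.q *
      Jagged.qPochInf (-(Jagged.b * Jagged.q ^ 2)) (Jagged.q ^ 2) *
      ∑' r : ℕ, Jagged.summand r := by
  have hq : Jagged.q ∣ -Jagged.q := (dvd_neg).2 dvd_rfl
  have hq2 : Jagged.q ∣ Jagged.q ^ 2 := dvd_pow_self _ two_ne_zero
  have hbq : Jagged.q ∣ -(Jagged.b * Jagged.q ^ 2) := (dvd_neg).2 (hq2.mul_left _)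
  have hsum := Jagged.hasSum_summand_mul
  set P := Jagged.qPochInf (-Jagged.q) Jagged.q with hP
  set Q := Jagged.qPochInf (-(Jagged.b * Jagged.q ^ 2)) (Jagged.q ^ 2) with hQ
  have hinv : P * Q * (P * Q)⁻¹ = 1 := by
    refine MvPowerSeries.mul_inv_cancel _ ?_
    rw [map_mul, hP, hQ, Jagged.constantCoeff_qPochInf hq dvd_rfl,
      Jagged.constantCoeff_qPochInf hbq hq2, mul_one]
    exact one_ne_zero
  -- Convergence of the sum over r is inherited from the combinatorial sum by dividing by the
  -- infinite products, which have constant coefficient 1.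
  have hS : Summable Jagged.summand := by
    refine (hsum.summable.mul_right (P * Q)⁻¹).congr fun i => ?_
    rw [mul_assoc (Jagged.summand i), mul_comm Q, mul_assoc, hinv, mul_one]
  refine ⟨Jagged.finite_overpartitions₂, Jagged.multipliable_qPoch hq dvd_rfl,
    Jagged.multipliable_qPoch hbq hq2, hS, ?_⟩
  refine hsum.unique ?_
  have := hS.hasSum.mul_left (P * Q)
  refine this.congr_fun fun i => ?_
  ring
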